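/- **Setting.** Let $n\ge 1$, $d\ge 0$ be integers, $c>0$, and $\mathbf B_d(c)=\{x\in\mathbb R^d:\|x\|_2\le c\}$. Client $i\in\{1,\dots,n\}$ holds $x_i\in\mathbf B_d(c)$, and $\mu=\frac1n\sum_i x_i$. A *SecAgg mean estimation scheme* over a finite abelian group $\mathcal Z$ consists of public randomness, randomized encoders that produce messages $Z_i\in\mathcal Z$ from $x_i$ (using the public randomness and independent private randomness), and a randomized decoder that outputs an estimate $\hat\mu\in\mathbb R^d$ from $\sum_i Z_i\in\mathcal Z$ and the public randomness. It costs each client $\log_2|\mathcal Z|$ bits. It is *$(\varepsilon,\delta)$-private* if what the server sees, i.e. the sum of the messages together with the public randomness, is $(\varepsilon,\delta)$-differentially private with respect to adding or removing one client. It has MSE at most $\xi$ if $\mathbb E\|\hat\mu-\mu\|_2^2\le\xi$ for all $x_1,\dots,x_n\in\mathbf B_d(c)$, and is *unbiased* if $\mathbb E[\hat\mu]=\mu$ for all $x_1,\dots,x_n\in\mathbf B_d(c)$. **Statement.** (a) There is a universal constant $C>0$ such that the following holds for all $n\ge1$, $d$, $c>0$, $\varepsilon,\delta\ge0$, $\xi>0$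 and every finite abelian group $\mathcal Z$. If an $(\varepsilon,\delta)$-private SecAgg mean estimation scheme over $\mathcal Z$ has MSE at most $\xi$, then $$\log_2|\mathcal Z|\ \ge\ C\,d\log_2(c^2/\xi).$$ If the scheme is moreover unbiased, then - if $\xi\ge c^2$, then $\log_2|\mathcal Z|\ge C\,dc^2/\xi$; - if $\xi\le c^2$, then $\log_2|\mathcal Z|\ge C\,d$; - if $\log_2|\mathcal Z|\le d$, then $\log_2|\mathcal Z|\ge C\,dc^2/\xi$, whatever $\xi$ is. (b) For every $K>0$ there is a constant $C_K>0$, depending only on $K$, such that every $(\varepsilon,\delta)$-private ($\varepsilon>0$, $\delta\ge0$) unbiased SecAgg mean estimation scheme over $\mathcal Z$ with MSE at most $K\,\frac{c^2d}{n^2\varepsilon^2}$ satisfies $$\log_2|\mathcal Z|\ \ge\ C_K\min(n^2\varepsilon^2,\,d).$$ -/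

import Mathlib

open MeasureTheory

/-- The closed Euclidean ball of radius `c` about the origin of `ℝ^d`. -/
abbrev EBall (d : ℕ) (c : ℝ) : Type :=
  Metric.closedBall (0 : EuclideanSpace ℝ (Fin d)) c

/-- The mean of the vectors held by the `n` clients. -/
noncomputable def clientMean {n d : ℕ} {c : ℝ} (x : Fin n → EBall d c) :
    EuclideanSpace ℝ (Fin d) :=
  (n : ℝ)⁻¹ • ∑ i, (x i : EuclideanSpace ℝ (Fin d))

/-- The number of bits `log₂ |Z|` that a client sends when messages are elements of `Z`. -/
noncomputable def commBits (Z : Type*) : ℝ := Real.logb 2 (Nat.card Z)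

/-- A one-round protocol for estimating the mean of `n` vectors of `EBall d c` by secure aggregation
over the additive group `Z`. The server broadcasts public randomness `r : R` (for instance a random
projection); client `i` has private randomness in `W` and encodes its vector into an element of `Z`;
the server only gets the sum in `Z` of the messages, which it decodes with private randomness
in `V`. -/
structure SecAggScheme (n d : ℕ) (c : ℝ) (Z R W V : Type*) [AddCommGroup Z]
    [MeasurableSpace Z] [MeasurableSpace R] [MeasurableSpace W] [MeasurableSpace V] where
  /-- law of the public randomness -/
  pubLaw : ProbabilityMeasure R
  /-- law of the private randomness of each client -/
  clientLaw : Fin n → ProbabilityMeasure W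
  /-- law of the private randomness of the decoder -/
  decLaw : ProbabilityMeasure V
  /-- the randomized encoder of each client -/
  enc : Fin n → EBall d c → R → W → Z
  /-- the randomized decoder of the server -/
  dec : Z → R → V → EuclideanSpace ℝ (Fin d)
  measurable_enc : ∀ i x, Measurable fun p : R × W => enc i x p.1 p.2
  measurable_dec : ∀ z, Measurable fun p : R × V => dec z p.1 p.2

namespace SecAggScheme

variable {n d : ℕ} {c : ℝ} {Z R W V : Type*} [AddCommGroup Z]
    [MeasurableSpace Z] [MeasurableSpace R] [MeasurableSpace W] [MeasurableSpace V]

/-- The joint law of all the randomness: the public randomness, the private randomness of each of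
the clients and that of the decoder are independent. -/
noncomputable def law (S : SecAggScheme n d c Z R W V) : Measure (R × (Fin n → W) × V) :=
  (S.pubLaw : Measure R).prod
    ((Measure.pi fun i => (S.clientLaw i : Measure W)).prod (S.decLaw : Measure V))

/-- The sum of the messages of the clients who take part. A dataset assigns to each client either
its vector, or `none` if that client is absent. -/
def aggregate (S : SecAggScheme n d c Z R W V) (D : Fin n → Option (EBall d c))
    (ω : R × (Fin n → W) × V) : Z :=
  ∑ i, (D i).elim 0 fun x => S.enc i x ω.1 (ω.2.1 i)

/-- The server's estimate of the mean when all `n` clients take part with vectors `x`. -/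
def estimate (S : SecAggScheme n d c Z R W V) (x : Fin n → EBall d c)
    (ω : R × (Fin n → W) × V) : EuclideanSpace ℝ (Fin d) :=
  S.dec (S.aggregate (fun i => some (x i)) ω) ω.1 ω.2.2

/-- Two datasets are neighbours if one of them arises from the other by removing one client. -/
def Neighbours (D D' : Fin n → Option (EBall d c)) : Prop :=
  ∃ i, (∀ j, j ≠ i → D j = D' j) ∧
    ((D i).isSome ∧ D' i = none ∨ D i = none ∧ (D' i).isSome)

/-- `(ε, δ)`-differential privacy of what the server observes, that is of the aggregated messages
(together with the public randomness). -/
def IsPrivate (S : SecAggScheme n d c Z R W V) (ε δ : ℝ) : Prop :=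
  ∀ D D' : Fin n → Option (EBall d c), Neighbours D D' →
    ∀ A : Set (R × Z), MeasurableSet A →
      S.law {ω | (ω.1, S.aggregate D ω) ∈ A} ≤
        ENNReal.ofReal (Real.exp ε) * S.law {ω | (ω.1, S.aggregate D' ω) ∈ A} + ENNReal.ofReal δ

/-- The mean squared error is at most `ξ` for all inputs in the ball. -/
def MSELe (S : SecAggScheme n d c Z R W V) (ξ : ℝ) : Prop :=
  ∀ x : Fin n → EBall d c,
    ∫⁻ ω, ‖S.estimate x ω - clientMean x‖ₑ ^ 2 ∂S.law ≤ ENNReal.ofReal ξ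

/-- The estimate is unbiased for all inputs in the ball. -/
def IsUnbiased (S : SecAggScheme n d c Z R W V) : Prop :=
  ∀ x : Fin n → EBall d c,
    Integrable (S.estimate x) S.law ∧ ∫ ω, S.estimate x ω ∂S.law = clientMean x

end SecAggScheme

/-! If all clients hold the same vector, the mean is that vector, and for fixed randomness the
decoder outputs one of at most `|Z|` points. A scheme is thus a random quantizer of the ball, and
few points cannot serve a large grid in dimension `d`.

The count uses a Gaussian kernel instead of a packing. Its sum over the grid is at most `B ^ d`
around any point, because it factors over coordinates, while Jensen bounds the expected kernel at
each grid point below through the MSE. Signs give a bound linear in `1 - ξ / c²`; a grid of `k ≈ c /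
√ξ` values per axis gives the logarithm.

For `ξ ≥ c²` unbiasedness is needed: shrinking an unbiased estimate suitably brings its MSE below
`c²`, where the sign bound applies (`MSELe.mul_sq_div_le`). The remaining claims follow by comparing
`ξ` with `c²`. -/

/-! ### Counting quantizer points with a Gaussian kernel -/

/-- A quantizer with `|Z|` (random) points whose mean squared error on each `x s` is at most `a`
satisfies `|ι| exp (-l a) ≤ |Z| B`, if the Gaussian kernel sums over the `x s` are at most `B`. -/
theorem card_mul_exp_le_card_mul {Ω E ι Z : Type*} [MeasurableSpace Ω] (P : Measure Ω)
    [IsProbabilityMeasure P] [NormedAddCommGroup E] [MeasurableSpace E] [BorelSpace E]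
    [Fintype ι] [Fintype Z] (x : ι → E) (y : Z → Ω → E) (hy : ∀ z, Measurable (y z))
    (k : ι → Ω → Z) (a l B : ℝ) (hl : 0 ≤ l)
    (hint : ∀ s, Integrable (fun ω => ‖y (k s ω) ω - x s‖ ^ 2) P)
    (ha : ∀ s, ∫ ω, ‖y (k s ω) ω - x s‖ ^ 2 ∂P ≤ a)
    (hB : ∀ v, ∑ s, Real.exp (-l * ‖v - x s‖ ^ 2) ≤ B) :
    Fintype.card ι * Real.exp (-l * a) ≤ Fintype.card Z * B := by
  have hg : ∀ z s, Integrable (fun ω => Real.exp (-l * ‖y z ω - x s‖ ^ 2)) P := by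
    intro z s
    have hcont : Continuous fun v : E => Real.exp (-l * ‖v - x s‖ ^ 2) := by fun_prop
    refine Integrable.of_bound (hcont.measurable.comp (hy z)).aestronglyMeasurable 1 ?_
    refine Filter.Eventually.of_forall fun ω => ?_
    rw [Real.norm_eq_abs, abs_of_pos (Real.exp_pos _), Real.exp_le_one_iff]
    have := sq_nonneg ‖y z ω - x s‖
    nlinarith
  have hs : ∀ s, Real.exp (-l * a) ≤ ∑ z, ∫ ω, Real.exp (-l * ‖y z ω - x s‖ ^ 2) ∂P := by
    intro s
    rw [← integral_finsetSum _ fun z _ => hg z s]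
    -- Jensen by hand: keep only the term `z = k s ω` and bound `exp` below by its tangent at `-l *
    -- a`.
    have hlin : ∀ ω, Real.exp (-l * a) * (1 + l * a) -
        Real.exp (-l * a) * l * ‖y (k s ω) ω - x s‖ ^ 2 ≤
        ∑ z, Real.exp (-l * ‖y z ω - x s‖ ^ 2) := by
      intro ω
      refine le_trans ?_ (Finset.single_le_sum
        (f := fun z => Real.exp (-l * ‖y z ω - x s‖ ^ 2))
        (fun z _ => (Real.exp_pos _).le) (Finset.mem_univ (k s ω)))
      have h := Real.add_one_le_exp (l * a - l * ‖y (k s ω) ω - x s‖ ^ 2)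
      have h2 := mul_le_mul_of_nonneg_left h (Real.exp_pos (-l * a)).le
      rw [← Real.exp_add] at h2
      calc _ = Real.exp (-l * a) * (l * a - l * ‖y (k s ω) ω - x s‖ ^ 2 + 1) := by ring
        _ ≤ _ := h2
        _ = _ := by congr 1; ring
    have hmono := integral_mono (μ := P)
      ((integrable_const (Real.exp (-l * a) * (1 + l * a))).sub
        ((hint s).const_mul (Real.exp (-l * a) * l)))
      (integrable_finsetSum Finset.univ fun z _ => hg z s) hlin
    refine le_trans ?_ hmono
    simp only [Pi.sub_apply]
    rw [integral_sub (integrable_const _) ((hint s).const_mul _),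
      integral_const_mul _ fun ω => ‖y (k s ω) ω - x s‖ ^ 2]
    simp only [integral_const, probReal_univ, one_smul]
    have := mul_le_mul_of_nonneg_left (ha s) (mul_nonneg (Real.exp_pos (-l * a)).le hl)
    linarith
  calc (Fintype.card ι : ℝ) * Real.exp (-l * a) = ∑ _s : ι, Real.exp (-l * a) := by simp
    _ ≤ ∑ s, ∑ z, ∫ ω, Real.exp (-l * ‖y z ω - x s‖ ^ 2) ∂P := Finset.sum_le_sum fun s _ => hs s
    _ = ∑ z, ∫ ω, ∑ s, Real.exp (-l * ‖y z ω - x s‖ ^ 2) ∂P := by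
        rw [Finset.sum_comm]
        refine Finset.sum_congr rfl fun z _ => ?_
        rw [integral_finsetSum _ fun s _ => hg z s]
    _ ≤ ∑ _z : Z, B := by
        refine Finset.sum_le_sum fun z _ => ?_
        have h := integral_mono (μ := P) (integrable_finsetSum Finset.univ fun s _ => hg z s)
          (integrable_const B) (fun ω => hB (y z ω))
        simpa using h
    _ = Fintype.card Z * B := by simp

/-! ### Product grids in the ball -/

/-- The point of `ℝ^d` with coordinates `(c / √d) * a (s i)`. -/
noncomputable def gridPoint {d k : ℕ} (c : ℝ) (a : Fin k → ℝ) (s : Fin d → Fin k) :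
    EuclideanSpace ℝ (Fin d) :=
  WithLp.toLp 2 fun i => c / √d * a (s i)

theorem norm_gridPoint_sq {d k : ℕ} (c : ℝ) (a : Fin k → ℝ) (s : Fin d → Fin k) :
    ‖gridPoint c a s‖ ^ 2 = c ^ 2 / d * ∑ i, a (s i) ^ 2 := by
  rw [EuclideanSpace.norm_sq_eq, Finset.mul_sum]
  refine Finset.sum_congr rfl fun i _ => ?_
  simp [gridPoint, mul_pow, div_pow]

theorem norm_gridPoint_le {d k : ℕ} {c : ℝ} (hc : 0 ≤ c) {a : Fin k → ℝ} (ha : ∀ j, |a j| ≤ 1)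
    (s : Fin d → Fin k) : ‖gridPoint c a s‖ ≤ c := by
  refine (pow_le_pow_iff_left₀ (norm_nonneg _) hc two_ne_zero).1 ?_
  rw [norm_gridPoint_sq]
  have h : ∑ i, a (s i) ^ 2 ≤ d := by
    calc ∑ i, a (s i) ^ 2 ≤ ∑ _i : Fin d, (1 : ℝ) :=
          Finset.sum_le_sum fun i _ => (sq_le_one_iff_abs_le_one _).2 (ha _)
      _ = d := by simp
  rcases Nat.eq_zero_or_pos d with rfl | hd
  · simpa using sq_nonneg c
  · have hd' : (0 : ℝ) < d := by exact_mod_cast hd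
    rw [div_mul_eq_mul_div, div_le_iff₀ hd']
    exact mul_le_mul_of_nonneg_left h (sq_nonneg c)

/-- One-dimensional Gaussian kernel sums tensorize over the grid. -/
theorem sum_exp_gridPoint_le {d k : ℕ} (hd : 0 < d) {c : ℝ} (hc : 0 < c) (a : Fin k → ℝ)
    (l B : ℝ) (hB : ∀ t, ∑ j, Real.exp (-l * (t - a j) ^ 2) ≤ B)
    (v : EuclideanSpace ℝ (Fin d)) :
    ∑ s : Fin d → Fin k, Real.exp (-(l * d / c ^ 2) * ‖v - gridPoint c a s‖ ^ 2) ≤ B ^ d := by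
  have hd' : (0 : ℝ) < d := by exact_mod_cast hd
  have hsq : √(d : ℝ) ^ 2 = d := Real.sq_sqrt hd'.le
  have hs0 : √(d : ℝ) ≠ 0 := (Real.sqrt_pos.2 hd').ne'
  calc _ = ∑ s : Fin d → Fin k, ∏ i, Real.exp (-l * (√d / c * v i - a (s i)) ^ 2) := by
        refine Finset.sum_congr rfl fun s _ => ?_
        rw [← Real.exp_sum, EuclideanSpace.norm_sq_eq, Finset.mul_sum]
        congr 1
        refine Finset.sum_congr rfl fun i _ => ?_
        simp only [gridPoint, PiLp.sub_apply, Real.norm_eq_abs, sq_abs]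
        have hv : v i - c / √d * a (s i) = c / √d * (√d / c * v i - a (s i)) := by
          field_simp
        rw [hv, mul_pow (c / √d), div_pow, hsq]
        field_simp
    _ = ∏ i, ∑ j, Real.exp (-l * (√d / c * v i - a j) ^ 2) := by
        rw [Finset.prod_univ_sum, Fintype.piFinset_univ]
    _ ≤ ∏ _i : Fin d, B :=
        Finset.prod_le_prod (fun i _ => Finset.sum_nonneg fun j _ => (Real.exp_pos _).le)
          fun i _ => hB _
    _ = B ^ d := by simp

theorem mul_log_sub_le_log_card {Ω Z : Type*} [MeasurableSpace Ω] (P : Measure Ω)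
    [IsProbabilityMeasure P] [Fintype Z] {d k : ℕ} (hd : 0 < d) (hk : 0 < k) {c : ℝ} (hc : 0 < c)
    (a : Fin k → ℝ) (y : Z → Ω → EuclideanSpace ℝ (Fin d)) (hy : ∀ z, Measurable (y z))
    (m : (Fin d → Fin k) → Ω → Z) (ξ l B : ℝ) (hl : 0 ≤ l) (hB0 : 0 < B)
    (hint : ∀ s, Integrable (fun ω => ‖y (m s ω) ω - gridPoint c a s‖ ^ 2) P)
    (hξ : ∀ s, ∫ ω, ‖y (m s ω) ω - gridPoint c a s‖ ^ 2 ∂P ≤ ξ)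
    (hB : ∀ t, ∑ j, Real.exp (-l * (t - a j) ^ 2) ≤ B) :
    d * (Real.log k - Real.log B - l * ξ / c ^ 2) ≤ Real.log (Fintype.card Z) := by
  have hk' : (0 : ℝ) < k := by exact_mod_cast hk
  have h := card_mul_exp_le_card_mul P (gridPoint c a) y hy m ξ (l * d / c ^ 2) (B ^ d)
    (by positivity) hint hξ (sum_exp_gridPoint_le hd hc a l B hB)
  simp only [Fintype.card_pi, Fintype.card_fin, Finset.prod_const, Finset.card_univ] at h
  push_cast at h
  have hpos : 0 < (k : ℝ) ^ d * Real.exp (-(l * d / c ^ 2) * ξ) := by positivity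
  have hZ : (0 : ℝ) < Fintype.card Z :=
    pos_of_mul_pos_left (hpos.trans_le h) (by positivity)
  have h2 := Real.log_le_log hpos h
  rw [Real.log_mul (by positivity) (by positivity), Real.log_mul hZ.ne' (by positivity),
    Real.log_exp, Real.log_pow, Real.log_pow] at h2
  calc _ = d * Real.log k + -(l * d / c ^ 2) * ξ - d * Real.log B := by ring
    _ ≤ _ := by linarith

/-! ### One-dimensional kernel sums -/

/-- On either side of `t` the `i`-th integer, counted from `0`, is at distance at least `i`, so each
side is dominated by a geometric series of sum at most 2. -/
theorem sum_exp_neg_sq_le_four (k : ℕ) (t : ℝ) :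
    ∑ j ∈ Finset.range k, Real.exp (-(t - j) ^ 2) ≤ 4 := by
  have hgeo : ∀ N : ℕ, ∑ i ∈ Finset.range N, (1 / 2 : ℝ) ^ i ≤ 2 := sum_geometric_two_le
  have hterm : ∀ (u : ℝ) (i : ℕ), (i : ℝ) ≤ |u| → Real.exp (-u ^ 2) ≤ (1 / 2 : ℝ) ^ i := by
    intro u i hi
    have h1 : (i : ℝ) ≤ u ^ 2 := by
      have h2 : (i : ℝ) ≤ (i : ℝ) ^ 2 := by exact_mod_cast Nat.le_self_pow two_ne_zero i
      have h3 : (i : ℝ) ^ 2 ≤ |u| ^ 2 := pow_le_pow_left₀ (by positivity) hi 2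
      rw [sq_abs] at h3
      linarith
    calc Real.exp (-u ^ 2) ≤ Real.exp (i * (-1)) := Real.exp_le_exp.2 (by linarith)
      _ = Real.exp (-1) ^ i := Real.exp_nat_mul _ _
      _ ≤ (1 / 2 : ℝ) ^ i := by
        refine pow_le_pow_left₀ (Real.exp_pos _).le ?_ i
        have := Real.add_one_le_exp (1 : ℝ)
        rw [Real.exp_neg, ← one_div]
        exact one_div_le_one_div_of_le (by norm_num) (by linarith)
  set m := ⌈t⌉₊ with hm
  calc ∑ j ∈ Finset.range k, Real.exp (-(t - j) ^ 2)
      ≤ ∑ j ∈ Finset.range (m + k), Real.exp (-(t - j) ^ 2) :=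
        Finset.sum_le_sum_of_subset_of_nonneg (Finset.range_mono (by omega))
          fun _ _ _ => (Real.exp_pos _).le
    _ = ∑ j ∈ Finset.range m, Real.exp (-(t - j) ^ 2) +
        ∑ i ∈ Finset.range k, Real.exp (-(t - (m + i : ℕ)) ^ 2) := Finset.sum_range_add _ _ _
    _ ≤ ∑ j ∈ Finset.range m, (1 / 2 : ℝ) ^ (m - 1 - j) + ∑ i ∈ Finset.range k, (1 / 2 : ℝ) ^ i := by
        refine add_le_add (Finset.sum_le_sum fun j hj => hterm _ _ ?_)
          (Finset.sum_le_sum fun i _ => hterm _ _ ?_)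
        · have hj' := Finset.mem_range.1 hj
          have h1 : ((m - 1 : ℕ) : ℝ) < t := Nat.lt_ceil.1 (by omega)
          rw [Nat.cast_sub (by omega)]
          exact le_trans (by linarith) (le_abs_self _)
        · have h1 : t ≤ m := Nat.le_ceil t
          push_cast
          exact le_trans (by linarith) (neg_le_abs _)
    _ ≤ 2 + 2 := by
        refine add_le_add ?_ (hgeo k)
        rw [Finset.sum_range_reflect fun i => (1 / 2 : ℝ) ^ i]
        exact hgeo m
    _ = 4 := by norm_num

/-- Factoring out the Gaussian in `t` leaves `cosh t ≤ exp (t² / 2)`. The rate `1 / 2` is the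
largest for which the midpoint is the maximum. -/
theorem exp_neg_half_sq_add_le (t : ℝ) :
    Real.exp (-(1 / 2) * (t - 1) ^ 2) + Real.exp (-(1 / 2) * (t + 1) ^ 2) ≤
      2 * Real.exp (-(1 / 2)) := by
  have h := mul_le_mul_of_nonneg_left (Real.cosh_le_exp_half_sq t)
    (mul_pos two_pos (Real.exp_pos (-(1 / 2) - t ^ 2 / 2))).le
  have h1 : Real.exp (-(1 / 2) * (t - 1) ^ 2) + Real.exp (-(1 / 2) * (t + 1) ^ 2) =
      2 * Real.exp (-(1 / 2) - t ^ 2 / 2) * Real.cosh t := by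
    rw [Real.cosh_eq, show -(1 / 2) * (t - 1) ^ 2 = (-(1 / 2) - t ^ 2 / 2) + t by ring,
      show -(1 / 2) * (t + 1) ^ 2 = (-(1 / 2) - t ^ 2 / 2) + -t by ring, Real.exp_add, Real.exp_add]
    ring
  rw [h1]
  refine h.trans_eq ?_
  rw [mul_assoc, ← Real.exp_add]
  ring_nf

/-! ### From schemes to quantizers -/

namespace SecAggScheme

variable {n d : ℕ} {c : ℝ} {Z R W V : Type*} [AddCommGroup Z]
    [MeasurableSpace Z] [MeasurableSpace R] [MeasurableSpace W] [MeasurableSpace V]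

instance (S : SecAggScheme n d c Z R W V) : IsProbabilityMeasure S.law := by
  unfold law; infer_instance

theorem measurable_dec_randomness (S : SecAggScheme n d c Z R W V) (z : Z) :
    Measurable fun ω : R × (Fin n → W) × V => S.dec z ω.1 ω.2.2 :=
  (S.measurable_dec z).comp (measurable_fst.prodMk (measurable_snd.comp measurable_snd))

variable [Finite Z] [DiscreteMeasurableSpace Z]

theorem measurable_aggregate (S : SecAggScheme n d c Z R W V)
    (D : Fin n → Option (EBall d c)) : Measurable (S.aggregate D) := by
  unfold aggregate
  refine Finset.measurable_fun_sum _ fun i _ => ?_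
  cases D i with
  | none => exact measurable_const
  | some x =>
    exact (S.measurable_enc i x).comp
      (measurable_fst.prodMk ((measurable_pi_apply i).comp (measurable_fst.comp measurable_snd)))

theorem measurable_estimate (S : SecAggScheme n d c Z R W V) (x : Fin n → EBall d c) :
    Measurable (S.estimate x) := by
  have h : Measurable fun p : Z × (R × (Fin n → W) × V) => S.dec p.1 p.2.1 p.2.2.2 :=
    measurable_from_prod_countable_right S.measurable_dec_randomness
  exact h.comp ((S.measurable_aggregate _).prodMk measurable_id)

theorem _root_.clientMean_const {n d : ℕ} {c : ℝ} (hn : 0 < n) (x : EBall d c) :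
    clientMean (fun _ : Fin n => x) = x := by
  have hn' : (n : ℝ) ≠ 0 := by exact_mod_cast hn.ne'
  simp [clientMean, ← Nat.cast_smul_eq_nsmul ℝ, smul_smul, hn']

theorem MSELe.integrable {S : SecAggScheme n d c Z R W V} {ξ : ℝ} (h : S.MSELe ξ)
    (x : Fin n → EBall d c) :
    Integrable (fun ω => ‖S.estimate x ω - clientMean x‖ ^ 2) S.law := by
  refine ⟨(((S.measurable_estimate x).sub_const _).norm.pow_const 2).aestronglyMeasurable, ?_⟩
  refine lt_of_le_of_lt (le_of_eq ?_) ((h x).trans_lt ENNReal.ofReal_lt_top)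
  simp

theorem MSELe.integral_le {S : SecAggScheme n d c Z R W V} {ξ : ℝ} (hξ : 0 ≤ ξ) (h : S.MSELe ξ)
    (x : Fin n → EBall d c) :
    ∫ ω, ‖S.estimate x ω - clientMean x‖ ^ 2 ∂S.law ≤ ξ := by
  rw [← ENNReal.ofReal_le_ofReal_iff hξ,
    ofReal_integral_eq_lintegral_ofReal (h.integrable x) (.of_forall fun ω => by positivity)]
  refine le_trans (le_of_eq ?_) (h x)
  refine lintegral_congr fun ω => ?_
  rw [ENNReal.ofReal_pow (norm_nonneg _), ofReal_norm]

theorem MSELe.mul_log_sub_le {S : SecAggScheme n d c Z R W V} {ξ : ℝ} (h : S.MSELe ξ)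
    (hξ : 0 ≤ ξ) (hn : 0 < n) (hd : 0 < d) (hc : 0 < c) {k : ℕ} (hk : 0 < k) (a : Fin k → ℝ)
    (ha : ∀ j, |a j| ≤ 1) {l B : ℝ} (hl : 0 ≤ l) (hB0 : 0 < B)
    (hB : ∀ t, ∑ j, Real.exp (-l * (t - a j) ^ 2) ≤ B) :
    d * (Real.log k - Real.log B - l * ξ / c ^ 2) ≤ Real.log (Nat.card Z) := by
  have := Fintype.ofFinite Z
  rw [Nat.card_eq_fintype_card]
  let x : (Fin d → Fin k) → EBall d c := fun s =>
    ⟨gridPoint c a s, mem_closedBall_zero_iff.2 (norm_gridPoint_le hc.le ha s)⟩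
  refine mul_log_sub_le_log_card S.law hd hk hc a (fun z ω => S.dec z ω.1 ω.2.2)
    S.measurable_dec_randomness (fun s => S.aggregate fun _ => some (x s)) ξ l B hl hB0
    (fun s => ?_) (fun s => ?_) hB
  · have h1 := h.integrable fun _ => x s
    rwa [clientMean_const hn] at h1
  · have h1 := h.integral_le hξ fun _ => x s
    rwa [clientMean_const hn] at h1

/-- The Gaussian kernel sum over the two signs is largest at the midpoint. -/
theorem _root_.sum_exp_sign_le (t : ℝ) :
    ∑ j, Real.exp (-(1 / 2) * (t - (![1, -1] : Fin 2 → ℝ) j) ^ 2) ≤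
      2 * Real.exp (-(1 / 2)) := by
  simpa [Fin.sum_univ_two] using exp_neg_half_sq_add_le t

theorem _root_.abs_sign_le (j : Fin 2) : |(![1, -1] : Fin 2 → ℝ) j| ≤ 1 := by
  fin_cases j <;> simp

/-- With signs the `log 2` of the grid size cancels against that of the kernel sum, so the bound
stays positive for every `ξ < c²`. -/
theorem MSELe.mul_one_sub_le {S : SecAggScheme n d c Z R W V} {ξ : ℝ} (h : S.MSELe ξ)
    (hξ : 0 ≤ ξ) (hn : 0 < n) (hd : 0 < d) (hc : 0 < c) :
    d * ((1 - ξ / c ^ 2) / 2) ≤ Real.log (Nat.card Z) := by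
  have h1 := h.mul_log_sub_le hξ hn hd hc two_pos ![1, -1] abs_sign_le (by norm_num)
    (by positivity) sum_exp_sign_le
  rw [Real.log_mul (by norm_num) (Real.exp_pos _).ne', Real.log_exp] at h1
  refine le_trans (le_of_eq ?_) h1
  push_cast
  ring

theorem MSELe.mul_log_natCast_sub_le {S : SecAggScheme n d c Z R W V} {ξ : ℝ} (h : S.MSELe ξ)
    (hξ : 0 ≤ ξ) (hn : 0 < n) (hd : 0 < d) (hc : 0 < c) {k : ℕ} (hk : 0 < k) :
    d * (Real.log k - Real.log 4 - k ^ 2 * ξ / c ^ 2) ≤ Real.log (Nat.card Z) := by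
  have hk' : (0 : ℝ) < k := by exact_mod_cast hk
  -- The rate `k ^ 2` turns spacing `1 / k` into unit spacing.
  refine h.mul_log_sub_le hξ hn hd hc hk (fun j => (j : ℝ) / k) (fun j => ?_) (by positivity)
    (by norm_num) (fun t => ?_)
  · rw [abs_of_nonneg (by positivity), div_le_one hk']
    exact_mod_cast j.2.le
  · refine le_trans (le_of_eq ?_) (sum_exp_neg_sq_le_four k (k * t))
    rw [Finset.sum_range]
    refine Finset.sum_congr rfl fun j _ => ?_
    congr 1
    field_simp

/-- Bias-variance decomposition: the cross term has mean zero by unbiasedness. -/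
theorem MSELe.integrable_smul {S : SecAggScheme n d c Z R W V} {ξ : ℝ} (h : S.MSELe ξ)
    (hu : S.IsUnbiased) (x : Fin n → EBall d c) (α : ℝ) :
    Integrable (fun ω => ‖α • S.estimate x ω - clientMean x‖ ^ 2) S.law ∧
    ∫ ω, ‖α • S.estimate x ω - clientMean x‖ ^ 2 ∂S.law =
      α ^ 2 * ∫ ω, ‖S.estimate x ω - clientMean x‖ ^ 2 ∂S.law +
        (α - 1) ^ 2 * ‖clientMean x‖ ^ 2 := by
  obtain ⟨hi, hm⟩ := hu x
  have hsub : Integrable (fun ω => S.estimate x ω - clientMean x) S.law :=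
    hi.sub (integrable_const _)
  have hpt : ∀ ω, ‖α • S.estimate x ω - clientMean x‖ ^ 2 =
      α ^ 2 * ‖S.estimate x ω - clientMean x‖ ^ 2 +
      2 * α * (α - 1) * inner ℝ (clientMean x) (S.estimate x ω - clientMean x) +
      (α - 1) ^ 2 * ‖clientMean x‖ ^ 2 := by
    intro ω
    rw [show α • S.estimate x ω - clientMean x =
      α • (S.estimate x ω - clientMean x) + (α - 1) • clientMean x by module,
      norm_add_sq_real, norm_smul, norm_smul, real_inner_smul_left, real_inner_smul_right,
      mul_pow, mul_pow, Real.norm_eq_abs, Real.norm_eq_abs, sq_abs, sq_abs, real_inner_comm]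
    ring
  have h1 := (h.integrable x).const_mul (α ^ 2)
  have h2 : Integrable (fun ω => 2 * α * (α - 1) *
      inner ℝ (clientMean x) (S.estimate x ω - clientMean x)) S.law :=
    (hsub.const_inner (clientMean x)).const_mul _
  have h0 : ∫ ω, inner ℝ (clientMean x) (S.estimate x ω - clientMean x) ∂S.law = 0 := by
    rw [integral_inner hsub, integral_sub hi (integrable_const _), hm]
    simp
  simp only [hpt]
  have h3 := h1.fun_add h2
  refine ⟨h3.fun_add (integrable_const _), ?_⟩
  rw [integral_add h3 (integrable_const _), integral_add h1 h2,
    integral_const_mul, integral_const_mul, h0]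
  simp

theorem MSELe.mul_sq_div_le {S : SecAggScheme n d c Z R W V} {ξ : ℝ} (h : S.MSELe ξ)
    (hu : S.IsUnbiased) (hξ : 0 ≤ ξ) (hn : 0 < n) (hd : 0 < d) (hc : 0 < c) :
    d * (c ^ 2 / (2 * (ξ + c ^ 2))) ≤ Real.log (Nat.card Z) := by
  have := Fintype.ofFinite Z
  rw [Nat.card_eq_fintype_card]
  have hpos : 0 < ξ + c ^ 2 := by positivity
  -- This minimizes `α² ξ + (α - 1)² c²`, with minimum `ξ c² / (ξ + c²) < c²`.
  set α := c ^ 2 / (ξ + c ^ 2) with hα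
  let x : (Fin d → Fin 2) → EBall d c := fun s =>
    ⟨gridPoint c ![1, -1] s, mem_closedBall_zero_iff.2 (norm_gridPoint_le hc.le abs_sign_le s)⟩
  have h1 := mul_log_sub_le_log_card S.law hd two_pos hc ![1, -1]
    (fun z ω => α • S.dec z ω.1 ω.2.2)
    (fun z => (S.measurable_dec_randomness z).const_smul α)
    (fun s => S.aggregate fun _ => some (x s)) (α ^ 2 * ξ + (α - 1) ^ 2 * c ^ 2) (1 / 2)
    (2 * Real.exp (-(1 / 2))) (by norm_num) (by positivity)
    (fun s => by
      have h2 := (h.integrable_smul hu (fun _ => x s) α).1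
      rwa [clientMean_const hn] at h2)
    (fun s => by
      have h2 := (h.integrable_smul hu (fun _ => x s) α).2
      have h3 := h.integral_le hξ (fun _ => x s)
      simp only [clientMean_const hn] at h2 h3
      refine h2.trans_le (add_le_add (mul_le_mul_of_nonneg_left h3 (sq_nonneg _))
        (mul_le_mul_of_nonneg_left ?_ (sq_nonneg _)))
      exact pow_le_pow_left₀ (norm_nonneg _) (norm_gridPoint_le hc.le abs_sign_le s) 2)
    sum_exp_sign_le
  rw [Real.log_mul (by norm_num) (Real.exp_pos _).ne', Real.log_exp] at h1
  refine le_trans (le_of_eq ?_) h1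
  rw [hα]
  push_cast
  field_simp
  ring

end SecAggScheme

/-! ### Explicit bounds on the number of bits -/

/-- Let `u = c² / ξ`. The sign bound covers `1 ≤ u ≤ exp 16`. Beyond, `k = ⌊√u⌋` loses at most `3
log 2 + 1 ≤ 4` from `log u / 2`, leaving at least `log u / 4`. -/
theorem mul_log_le_of_forall_natCast {d c ξ L : ℝ} (hd : 0 ≤ d) (hc : 0 < c) (hξ : 0 < ξ)
    (hL : 0 ≤ L) (h1 : d * ((1 - ξ / c ^ 2) / 2) ≤ L)
    (h2 : ∀ k : ℕ, 0 < k → d * (Real.log k - Real.log 4 - k ^ 2 * ξ / c ^ 2) ≤ L) :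
    Real.exp (-16) / 4 * (d * Real.log (c ^ 2 / ξ)) ≤ L := by
  set u := c ^ 2 / ξ with hu
  have hu0 : 0 < u := by positivity
  have hinv : ξ / c ^ 2 = u⁻¹ := by rw [hu, inv_div]
  have he := Real.exp_pos (-16)
  rcases le_total u 1 with hu1 | hu1
  · have := Real.log_nonpos hu0.le hu1
    have h3 : Real.exp (-16) / 4 * (d * Real.log u) ≤ 0 :=
      mul_nonpos_of_nonneg_of_nonpos (by positivity) (mul_nonpos_of_nonneg_of_nonpos hd this)
    exact h3.trans hL
  have hlog0 := Real.log_nonneg hu1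
  rcases le_total (Real.log u) 16 with h16 | h16
  · have hexp : Real.exp (-16) ≤ u⁻¹ := by
      rw [Real.exp_neg]
      exact inv_anti₀ hu0 ((Real.log_le_iff_le_exp hu0).1 h16)
    have h3 : Real.exp (-16) * Real.log u ≤ 1 - u⁻¹ := by
      calc Real.exp (-16) * Real.log u ≤ u⁻¹ * (u - 1) :=
            mul_le_mul hexp (Real.log_le_sub_one_of_pos hu0) hlog0 (by positivity)
        _ = 1 - u⁻¹ := by field_simp
    rw [hinv] at h1
    have h4 := mul_le_mul_of_nonneg_left h3 hd
    have h5 : 0 ≤ d * (Real.exp (-16) * Real.log u) := by positivity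
    linarith
  · have hs1 : 1 ≤ √u := Real.one_le_sqrt.2 hu1
    set k := ⌊√u⌋₊ with hk
    have hk0 : 0 < k := Nat.floor_pos.2 hs1
    have hk1 : (1 : ℝ) ≤ k := by exact_mod_cast hk0
    have hku : (k : ℝ) ≤ √u := Nat.floor_le (Real.sqrt_nonneg u)
    have hku' : √u / 2 ≤ k := by
      have := Nat.lt_floor_add_one √u
      rw [← hk] at this
      linarith
    have hsq : (k : ℝ) ^ 2 * ξ / c ^ 2 ≤ 1 := by
      rw [mul_div_assoc, hinv, ← div_eq_mul_inv, div_le_one hu0]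
      calc (k : ℝ) ^ 2 ≤ √u ^ 2 := pow_le_pow_left₀ (by positivity) hku 2
        _ = u := Real.sq_sqrt hu0.le
    have hlk : Real.log u / 2 - Real.log 2 ≤ Real.log k := by
      rw [← Real.log_sqrt hu0.le, ← Real.log_div (by positivity) (by norm_num)]
      exact Real.log_le_log (by positivity) hku'
    have hl2 : Real.log 2 ≤ 1 := by linarith [Real.log_two_lt_d9]
    have hl4 : Real.log 4 = 2 * Real.log 2 := by
      rw [show (4 : ℝ) = 2 ^ 2 by norm_num, Real.log_pow]
      norm_num
    have he1 : Real.exp (-16) ≤ 1 := Real.exp_le_one_iff.2 (by norm_num)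
    refine le_trans ?_ (h2 k hk0)
    rw [mul_left_comm]
    refine mul_le_mul_of_nonneg_left ?_ hd
    have := mul_le_mul_of_nonneg_right he1 hlog0
    linarith

theorem commBits_mul_log_two (Z : Type*) : commBits Z * Real.log 2 = Real.log (Nat.card Z) :=
  div_mul_cancel₀ _ (Real.log_pos one_lt_two).ne'

theorem commBits_nonneg (Z : Type*) : 0 ≤ commBits Z :=
  div_nonneg (Real.log_natCast_nonneg _) (Real.log_pos one_lt_two).le

theorem log_card_le_commBits (Z : Type*) : Real.log (Nat.card Z) ≤ commBits Z := by
  rw [← commBits_mul_log_two]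
  exact mul_le_of_le_one_right (commBits_nonneg Z) (by linarith [Real.log_two_lt_d9])

namespace SecAggScheme

variable {n d : ℕ} {c ξ : ℝ} {Z R W V : Type*} [AddCommGroup Z] [Finite Z]
    [MeasurableSpace Z] [DiscreteMeasurableSpace Z]
    [MeasurableSpace R] [MeasurableSpace W] [MeasurableSpace V] {S : SecAggScheme n d c Z R W V}

theorem MSELe.mul_logb_le_commBits (h : S.MSELe ξ) (hn : 0 < n) (hc : 0 < c) (hξ : 0 < ξ) :
    Real.exp (-16) / 4 * (d * Real.logb 2 (c ^ 2 / ξ)) ≤ commBits Z := by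
  rcases Nat.eq_zero_or_pos d with rfl | hd
  · simpa using commBits_nonneg Z
  have h1 := mul_log_le_of_forall_natCast (Nat.cast_nonneg d) hc hξ
    (Real.log_natCast_nonneg (Nat.card Z)) (h.mul_one_sub_le hξ.le hn hd hc)
    fun k hk => h.mul_log_natCast_sub_le hξ.le hn hd hc hk
  rw [commBits, Real.logb, Real.logb, ← mul_div_assoc, ← mul_div_assoc]
  exact div_le_div_of_nonneg_right h1 (Real.log_pos one_lt_two).le

theorem MSELe.mul_sq_div_le_commBits (h : S.MSELe ξ) (hu : S.IsUnbiased) (hn : 0 < n)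
    (hc : 0 < c) (hξ : 0 < ξ) : d * (c ^ 2 / (2 * (ξ + c ^ 2))) ≤ commBits Z := by
  rcases Nat.eq_zero_or_pos d with rfl | hd
  · simpa using commBits_nonneg Z
  exact (h.mul_sq_div_le hu hξ.le hn hd hc).trans (log_card_le_commBits Z)

theorem MSELe.mul_sq_div_le_commBits_of_le (h : S.MSELe ξ) (hu : S.IsUnbiased) (hn : 0 < n)
    (hc : 0 < c) (hξ : 0 < ξ) (hcξ : c ^ 2 ≤ ξ) : 1 / 4 * (d * c ^ 2 / ξ) ≤ commBits Z := by
  refine le_trans ?_ (h.mul_sq_div_le_commBits hu hn hc hξ)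
  have h1 : c ^ 2 / (2 * (ξ + ξ)) ≤ c ^ 2 / (2 * (ξ + c ^ 2)) :=
    div_le_div_of_nonneg_left (by positivity) (by positivity) (by linarith)
  refine le_trans (le_of_eq ?_) (mul_le_mul_of_nonneg_left h1 (Nat.cast_nonneg d))
  field_simp
  ring

theorem MSELe.dim_le_commBits_of_le (h : S.MSELe ξ) (hu : S.IsUnbiased) (hn : 0 < n)
    (hc : 0 < c) (hξ : 0 < ξ) (hcξ : ξ ≤ c ^ 2) : 1 / 4 * (d : ℝ) ≤ commBits Z := by
  refine le_trans ?_ (h.mul_sq_div_le_commBits hu hn hc hξ)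
  have h1 : c ^ 2 / (2 * (c ^ 2 + c ^ 2)) ≤ c ^ 2 / (2 * (ξ + c ^ 2)) :=
    div_le_div_of_nonneg_left (by positivity) (by positivity) (by linarith)
  refine le_trans (le_of_eq ?_) (mul_le_mul_of_nonneg_left h1 (Nat.cast_nonneg d))
  field_simp
  ring

/-- When `ξ ≤ c²`, the logarithmic bound and `commBits Z ≤ d` keep `c² / ξ` below a constant, so the
bound by `d` suffices. The exponent `4 * exp 16` inverts the constant `exp (-16) / 4`. -/
theorem MSELe.mul_sq_div_le_commBits_of_commBits_le (h : S.MSELe ξ) (hu : S.IsUnbiased)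
    (hn : 0 < n) (hc : 0 < c) (hξ : 0 < ξ) (hd : commBits Z ≤ d) :
    2⁻¹ ^ (4 * Real.exp 16) / 4 * (d * c ^ 2 / ξ) ≤ commBits Z := by
  have hpow : (2⁻¹ : ℝ) ^ (4 * Real.exp 16) ≤ 1 :=
    Real.rpow_le_one (by norm_num) (by norm_num) (by positivity)
  rcases le_total (c ^ 2) ξ with hcξ | hcξ
  · refine le_trans ?_ (h.mul_sq_div_le_commBits_of_le hu hn hc hξ hcξ)
    exact mul_le_mul_of_nonneg_right (by linarith) (by positivity)
  rcases Nat.eq_zero_or_pos d with rfl | hd0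
  · simpa using commBits_nonneg Z
  have hd' : (0 : ℝ) < d := by exact_mod_cast hd0
  have hu0 : 0 < c ^ 2 / ξ := by positivity
  have h1 := (h.mul_logb_le_commBits hn hc hξ).trans hd
  have h2 : Real.logb 2 (c ^ 2 / ξ) ≤ 4 * Real.exp 16 := by
    rw [mul_left_comm] at h1
    have h3 := (mul_le_iff_le_one_right hd').1 h1
    rw [Real.exp_neg] at h3
    have he := Real.exp_pos 16
    field_simp at h3
    linarith
  have h4 : c ^ 2 / ξ ≤ 2 ^ (4 * Real.exp 16) := (Real.logb_le_iff_le_rpow one_lt_two hu0).1 h2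
  refine le_trans ?_ (h.dim_le_commBits_of_le hu hn hc hξ hcξ)
  have h5 : (2⁻¹ : ℝ) ^ (4 * Real.exp 16) * (c ^ 2 / ξ) ≤ 1 := by
    rw [Real.inv_rpow (by norm_num), inv_mul_le_iff₀ (by positivity), mul_one]
    exact h4
  calc _ = d / 4 * ((2⁻¹ : ℝ) ^ (4 * Real.exp 16) * (c ^ 2 / ξ)) := by ring
    _ ≤ d / 4 * 1 := mul_le_mul_of_nonneg_left h5 (by positivity)
    _ = _ := by ring

theorem MSELe.min_le_commBits {K ε : ℝ} (hK : 0 < K) (hε : 0 < ε)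
    (h : S.MSELe (K * (c ^ 2 * d / (n ^ 2 * ε ^ 2)))) (hu : S.IsUnbiased) (hn : 0 < n)
    (hc : 0 < c) :
    min (1 / 4) (1 / (4 * K)) * min ((n : ℝ) ^ 2 * ε ^ 2) d ≤ commBits Z := by
  have hn' : (0 : ℝ) < n := by exact_mod_cast hn
  rcases Nat.eq_zero_or_pos d with rfl | hd
  · have : min ((n : ℝ) ^ 2 * ε ^ 2) ((0 : ℕ) : ℝ) = 0 := by
      rw [Nat.cast_zero]
      exact min_eq_right (by positivity)
    rw [this, mul_zero]
    exact commBits_nonneg Z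
  have hd' : (0 : ℝ) < d := by exact_mod_cast hd
  set ξ := K * (c ^ 2 * d / (n ^ 2 * ε ^ 2)) with hξ
  have hξ0 : 0 < ξ := by positivity
  rcases le_total (c ^ 2) ξ with hcξ | hcξ
  -- For this `ξ`, `d c² / ξ` equals `n² ε² / K`.
  · refine le_trans (mul_le_mul (min_le_right _ _) (min_le_left _ _) (by positivity)
      (by positivity)) (le_trans (le_of_eq ?_)
      (h.mul_sq_div_le_commBits_of_le hu hn hc hξ0 hcξ))
    rw [hξ]
    field_simp
  · exact (mul_le_mul (min_le_left _ _) (min_le_right _ _) (by positivity)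
      (by positivity)).trans (h.dim_le_commBits_of_le hu hn hc hξ0 hcξ)

end SecAggScheme

/-! ### Assembling the universal constants -/

theorem mainTheorem3 :
    (∃ C : ℝ, 0 < C ∧
      ∀ (n d : ℕ) (c : ℝ) (Z R W V : Type*) [AddCommGroup Z] [Finite Z]
        [MeasurableSpace Z] [DiscreteMeasurableSpace Z]
        [MeasurableSpace R] [MeasurableSpace W] [MeasurableSpace V]
        (S : SecAggScheme n d c Z R W V) (ε δ ξ : ℝ),
        0 < n → 0 < c → 0 ≤ ε → 0 ≤ δ → 0 < ξ → S.IsPrivate ε δ → S.MSELe ξ →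
          C * (d * Real.logb 2 (c ^ 2 / ξ)) ≤ commBits Z ∧
          (S.IsUnbiased →
            (c ^ 2 ≤ ξ → C * (d * c ^ 2 / ξ) ≤ commBits Z) ∧
            (ξ ≤ c ^ 2 → C * d ≤ commBits Z) ∧
            (commBits Z ≤ d → C * (d * c ^ 2 / ξ) ≤ commBits Z))) ∧
    (∀ K : ℝ, 0 < K → ∃ C : ℝ, 0 < C ∧
      ∀ (n d : ℕ) (c : ℝ) (Z R W V : Type*) [AddCommGroup Z] [Finite Z]
        [MeasurableSpace Z] [DiscreteMeasurableSpace Z]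
        [MeasurableSpace R] [MeasurableSpace W] [MeasurableSpace V]
        (S : SecAggScheme n d c Z R W V) (ε δ : ℝ),
        0 < n → 0 < c → 0 < ε → 0 ≤ δ → S.IsPrivate ε δ → S.IsUnbiased →
          S.MSELe (K * (c ^ 2 * d / (n ^ 2 * ε ^ 2))) →
            C * min ((n : ℝ) ^ 2 * ε ^ 2) d ≤ commBits Z) := by
  refine ⟨?_, fun K hK => ⟨min (1 / 4) (1 / (4 * K)), by positivity, ?_⟩⟩
  · have hpow0 : 0 < (2⁻¹ : ℝ) ^ (4 * Real.exp 16) := by positivity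
    have hpow : (2⁻¹ : ℝ) ^ (4 * Real.exp 16) ≤ 1 :=
      Real.rpow_le_one (by norm_num) (by norm_num) (by positivity)
    refine ⟨min (Real.exp (-16) / 4) (2⁻¹ ^ (4 * Real.exp 16) / 4), by positivity, ?_⟩
    set C := min (Real.exp (-16) / 4) ((2⁻¹ : ℝ) ^ (4 * Real.exp 16) / 4) with hC
    have hC0 : 0 < C := by positivity
    have hC1 : C ≤ Real.exp (-16) / 4 := min_le_left _ _
    have hC2 : C ≤ 2⁻¹ ^ (4 * Real.exp 16) / 4 := min_le_right _ _
    intro n d c Z R W V _ _ _ _ _ _ _ S ε δ ξ hn hc _ _ hξ _ h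
    refine ⟨?_, fun hu => ⟨fun hcξ => ?_, fun hcξ => ?_, fun hd => ?_⟩⟩
    · rcases le_total 0 (d * Real.logb 2 (c ^ 2 / ξ)) with h0 | h0
      · exact (mul_le_mul_of_nonneg_right hC1 h0).trans (h.mul_logb_le_commBits hn hc hξ)
      · exact (mul_nonpos_of_nonneg_of_nonpos hC0.le h0).trans (commBits_nonneg Z)
    · exact (mul_le_mul_of_nonneg_right (by linarith) (by positivity)).trans
        (h.mul_sq_div_le_commBits_of_le hu hn hc hξ hcξ)
    · exact (mul_le_mul_of_nonneg_right (by linarith) (by positivity)).trans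
        (h.dim_le_commBits_of_le hu hn hc hξ hcξ)
    · exact (mul_le_mul_of_nonneg_right hC2 (by positivity)).trans
        (h.mul_sq_div_le_commBits_of_commBits_le hu hn hc hξ hd)
  · intro n d c Z R W V _ _ _ _ _ _ _ S ε δ hn hc hε _ _ hu h
    exact h.min_le_commBits hK hε hu hn hc
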